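/- Let $n\ge 1$ and let $W$ be the Weyl group of type $B_n$, acting on $\mathfrak h^*=\mathbb K^n$ ($\mathbb K$ a field of characteristic $0$, e.g. $\mathbb C$ or $\mathbb R$) with standard basis $\varepsilon_1,\dots,\varepsilon_n$, generated by the reflections $s_1,\dots,s_n$ in the simple roots $\alpha_i=\varepsilon_i-\varepsilon_{i+1}$ ($i<n$) and $\alpha_n=\varepsilon_n$. Let $w=s_n(s_{n-1}s_n)\cdots(s_1s_2\cdots s_n)$ with this fixed reduced word $s_{i_1}\cdots s_{i_t}$, $t=n(n+1)/2$; its letters fill, row by row from the top and from left to right, the staircase tableau whose $r$-th row has $r$ boxes. A diagram $\Delta$ is a set of boxes (the black ones), identified with a subset of $\{1,\dots,t\}$. Put $s_{i_k}^\Delta=s_{i_k}$ if $k\in\Delta$ and $s_{i_k}^\Delta=\mathrm{id}$ otherwise, $w^\Delta=s_{i_1}^\Delta\cdots s_{i_t}^\Delta$ and $v_\ell^\Delta=s_{i_t}^\Delta\cdots s_{i_{t-\ell+1}}^\Delta$. The diagram $\Delta$ is Cauchon if $v_{\ell-1}^\Delta<v_{\ell-1}^\Delta s_{i_{t-\ell+1}}$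 in the Bruhat order for all $1\le\ell\le t$. Given $\Delta$, colour the $n\times n$ grid so that its lower triangular part (with the diagonal) is $\Delta$ and its upper triangular part is the reflection of $\Delta$ in the diagonal. Label the rows $1,\dots,n$ from the bottom and the columns $-n,\dots,-1$ from the left. Let $\tau_\Delta$ be the permutation of $[n]\cup(-[n])$ that sends $i$ (on the right or bottom side) to the label on the left or top side that is reached by the pipe starting at $i$, where a pipe goes straight across each black square, and in each white square a pipe entering from the right turns upwards and a pipe entering from below turns to the left. In what follows $R_1,R_2,\dots$ are nonempty, increasing, pairwise disjoint sequences in $[n]$, and $-R$ is obtained from $R$ by negating the entries. For $m\ge1$, a type (b) cycle pair of $\tau_\Delta$ is an unordered pair of cycles of $\tau_\Delta$ of the form $(R_1,-R_2,R_3,\dots,-R_{2m})$, $(-R_1,R_2,-R_3,\dots,R_{2m})$; a type (c) cycle is a cycle of the form $(R_1,-R_2,\dots,R_{2m-1},-R_1,R_2,\dots,-R_{2m-1})$. Each is called even or odd according to the parity of $\sum_i|R_i|$. **Theorem.** Let $\Delta$ be a Cauchon diagram. Then $\dim\ker(w^\Delta+w)$ equals the number of even type (b) cycle pairs plus the number of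 odd type (c) cycles of $\tau=\tau_\Delta$. Moreover, for each even type (b) pair and each odd type (c) cycle $C$, fix any way of writing it with sequences $R_1,R_2,\dots$ as above, let $a$ be the first entry of $R_1$, let $r=\sum_i|R_i|$, and define $v_C\in\mathbb K^n$ by $$(v_C)_{|\tau^j(a)|}=(-1)^j\prod_{\ell=1}^{j}P\bigl[|\tau^{\ell-1}(a)|,|\tau^{\ell}(a)|\bigr]\qquad(0\le j<r),$$ all other components being $0$, where $P[i,k]=1$ if $\tau(i)=k$, $P[i,k]=-1$ if $\tau(i)=-k$, and $P[i,k]=0$ otherwise. Then the vectors $w^{-1}v_C$, indexed by these $C$, form a basis of $\ker(w^\Delta+w)$. -/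

import Mathlib

namespace TypeB

/-! ### The Weyl group of type `B_n` acting on the dual of the Cartan subalgebra

The space is `𝕜^n` with its standard basis `ε_1, …, ε_n`. The index `k : Fin n` stands for the
number `k + 1` of `{1, …, n}`. -/

section Weyl

variable (𝕜 : Type*) [Field 𝕜] {n : ℕ}

/-- `α_i = ε_i - ε_{i+1}` for `i < n`, and `α_n = ε_n` is the short simple root. -/
def simpleRoot (i : Fin n) : Fin n → 𝕜 :=
  if h : (i : ℕ) + 1 < n then Pi.single i 1 - Pi.single ⟨(i : ℕ) + 1, h⟩ 1 else Pi.single i 1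

/-- The coroot of `α_i`, that is, the functional `x ↦ 2 (x, α_i) / (α_i, α_i)`. -/
def simpleCoroot (i : Fin n) : Module.Dual 𝕜 (Fin n → 𝕜) :=
  if h : (i : ℕ) + 1 < n then LinearMap.proj i - LinearMap.proj ⟨(i : ℕ) + 1, h⟩
  else (2 : 𝕜) • LinearMap.proj i

theorem simpleCoroot_simpleRoot (i : Fin n) : simpleCoroot 𝕜 i (simpleRoot 𝕜 i) = 2 := by
  unfold simpleCoroot simpleRoot
  split_ifs with h
  · have h1 : i ≠ ⟨(i : ℕ) + 1, h⟩ := by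
      intro h2
      have := congrArg Fin.val h2
      simp at this
    simp [h1, h1.symm]
    norm_num
  · simp

/-- The simple reflection `s_i`, `x ↦ x - ⟨x, α_i^∨⟩ α_i`. -/
noncomputable def simpleReflection (i : Fin n) : (Fin n → 𝕜) ≃ₗ[𝕜] (Fin n → 𝕜) :=
  Module.reflection (simpleCoroot_simpleRoot 𝕜 i)

/-- The Weyl group `W`. -/
def weylGroup (n : ℕ) : Subgroup ((Fin n → 𝕜) ≃ₗ[𝕜] (Fin n → 𝕜)) :=
  Subgroup.closure (Set.range (simpleReflection 𝕜))

/-- The length of an element of the Weyl group. -/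
noncomputable def length (g : (Fin n → 𝕜) ≃ₗ[𝕜] (Fin n → 𝕜)) : ℕ :=
  sInf {l | ∃ L : List (Fin n), L.length = l ∧ (L.map (simpleReflection 𝕜)).prod = g}

/-- The reflections of the Weyl group: the conjugates of the simple reflections. -/
def IsWeylReflection (t : (Fin n → 𝕜) ≃ₗ[𝕜] (Fin n → 𝕜)) : Prop :=
  ∃ g ∈ weylGroup 𝕜 n, ∃ i : Fin n, t = g * simpleReflection 𝕜 i * g⁻¹

/-- The strict Bruhat order on `W`: the transitive closure of the relation `u < u t`, where
`u ∈ W`, `t` is a reflection of `W` and `ℓ(u) < ℓ(u t)`. -/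
def BruhatLT : ((Fin n → 𝕜) ≃ₗ[𝕜] (Fin n → 𝕜)) → ((Fin n → 𝕜) ≃ₗ[𝕜] (Fin n → 𝕜)) → Prop :=
  Relation.TransGen fun u v =>
    u ∈ weylGroup 𝕜 n ∧ ∃ t, IsWeylReflection 𝕜 t ∧ v = u * t ∧ length 𝕜 u < length 𝕜 v

end Weyl

/-! ### The Young tableau and Cauchon diagrams -/

/-- The boxes of the staircase tableau: the row `r` has the columns `0, …, r`. Rows are counted
from the top and columns from the left, both from `0`. -/
abbrev Box (n : ℕ) : Type := Σ r : Fin n, Fin ((r : ℕ) + 1)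

/-- All boxes in reading order: rows from top to bottom, each from left to right. -/
def boxes (n : ℕ) : List (Box n) :=
  (List.finRange n).flatMap fun r : Fin n =>
    (List.finRange ((r : ℕ) + 1)).map fun c => (⟨r, c⟩ : Box n)

/-- The index of the simple reflection in a box: the first row holds `s_n`, the second
`s_{n-1}, s_n`, and so on, and the last one `s_1, …, s_n`. -/
def boxIndex {n : ℕ} (b : Box n) : Fin n :=
  ⟨n - 1 - (b.1 : ℕ) + (b.2 : ℕ), by have h1 := b.1.isLt; have h2 := b.2.isLt; omega⟩

section Diagram

variable (𝕜 : Type*) [Field 𝕜] {n : ℕ}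

/-- `w = s_n (s_{n-1} s_n) ⋯ (s_1 s_2 ⋯ s_n)`. -/
noncomputable def maxElt (n : ℕ) : (Fin n → 𝕜) ≃ₗ[𝕜] (Fin n → 𝕜) :=
  ((boxes n).map fun b => simpleReflection 𝕜 (boxIndex b)).prod

/-- The reflection of the box if the box is in `Δ`, and the identity otherwise. -/
noncomputable def subReflection (Δ : Finset (Box n)) (b : Box n) :
    (Fin n → 𝕜) ≃ₗ[𝕜] (Fin n → 𝕜) :=
  if b ∈ Δ then simpleReflection 𝕜 (boxIndex b) else 1

/-- `w^Δ`, the product of the reflections of the black boxes in reading order. -/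
noncomputable def subElt (Δ : Finset (Box n)) : (Fin n → 𝕜) ≃ₗ[𝕜] (Fin n → 𝕜) :=
  ((boxes n).map (subReflection 𝕜 Δ)).prod

/-- `v_ℓ^Δ`, the product over the last `ℓ` boxes, in the reverse of the reading order. -/
noncomputable def revSubElt (Δ : Finset (Box n)) (l : ℕ) : (Fin n → 𝕜) ≃ₗ[𝕜] (Fin n → 𝕜) :=
  (((boxes n).reverse.take l).map (subReflection 𝕜 Δ)).prod

/-- The diagram `Δ` (the set of the black boxes) is Cauchon: `v_ℓ^Δ < v_ℓ^Δ s` in the Bruhat order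
for `0 ≤ ℓ < n(n+1)/2`, where `s` is the simple reflection of the box that has exactly `ℓ` boxes
after it in reading order. -/
def IsCauchon (Δ : Finset (Box n)) : Prop :=
  ∀ (l : ℕ) (hl : l < (boxes n).reverse.length),
    BruhatLT 𝕜 (revSubElt 𝕜 Δ l)
      (revSubElt 𝕜 Δ l * simpleReflection 𝕜 (boxIndex ((boxes n).reverse[l])))

end Diagram

/-! ### Pipe dreams -/

/-- The set `[n] ∪ -[n]`: the pair `(ε, k)` stands for `ε (k + 1)`. -/
abbrev SignedIndex (n : ℕ) : Type := ℤˣ × Fin n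

/-- The square in row `r` (from the top) and column `c` (from the left), counted from `0`, of the
`n × n` grid is black in the symmetric diagram of `Δ`: the lower triangular part is `Δ`, and the
upper triangular part is its reflection. -/
def IsBlack {n : ℕ} (Δ : Finset (Box n)) (r c : ℕ) : Prop :=
  ∃ b ∈ Δ, ((b.1 : ℕ) = r ∧ (b.2 : ℕ) = c) ∨ ((b.1 : ℕ) = c ∧ (b.2 : ℕ) = r)

instance {n : ℕ} (Δ : Finset (Box n)) (r c : ℕ) : Decidable (IsBlack Δ r c) := by
  unfold IsBlack; infer_instance

inductive Heading
  | left
  | up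

/-- The label of a pipe that leaves the grid. Rows are labelled `1, …, n` from the bottom, and
columns `-n, …, -1` from the left. `left`: at the left end of row `r`. `up`: at the top of
column `r`. -/
def exitLabel {n : ℕ} (hn : 0 < n) (d : Heading) (r : ℕ) : SignedIndex n :=
  (match d with | .left => 1 | .up => -1, ⟨n - 1 - r, by omega⟩)

/-- Follow a pipe to the top or the left side of the grid.
`left r c`: the pipe runs to the left in row `r`, with the `c` columns `0, …, c - 1` in front of it.
`up r c`: the pipe runs upwards in column `c`, with the `r` rows `0, …, r - 1` in front of it.
A black square is crossed straight. In a white square a pipe that comes from the right turns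
upwards, and one that comes from below turns to the left. -/
def followPipe {n : ℕ} (hn : 0 < n) (Δ : Finset (Box n)) : Heading → ℕ → ℕ → SignedIndex n
  | .left, r, 0 => exitLabel hn .left r
  | .left, r, c + 1 => if IsBlack Δ r c then followPipe hn Δ .left r c else followPipe hn Δ .up r c
  | .up, 0, c => exitLabel hn .up c
  | .up, r + 1, c => if IsBlack Δ r c then followPipe hn Δ .up r c else followPipe hn Δ .left r c
termination_by _ r c => r + c

/-- The end of the pipe that starts at `i` on the right side (`i > 0`, row `i`) or on the bottom
side (`i < 0`, column `i`). -/
def pipeEnd {n : ℕ} (Δ : Finset (Box n)) (i : SignedIndex n) : SignedIndex n :=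
  if i.1 = 1 then followPipe (Fin.pos i.2) Δ .left (n - 1 - i.2) n
  else followPipe (Fin.pos i.2) Δ .up n (n - 1 - i.2)

theorem followPipe_mem_range {n : ℕ} (hn : 0 < n) (Δ : Finset (Box n)) (k : ℕ) :
    ∀ r c : ℕ, 2 * n ≤ r + c + k →
      (r < n → c ≤ n → ∃ i, pipeEnd Δ i = followPipe hn Δ .left r c) ∧
      (r ≤ n → c < n → ∃ i, pipeEnd Δ i = followPipe hn Δ .up r c) := by
  induction k with
  | zero =>
    intro r c h
    exact ⟨fun h1 h2 => by omega, fun h1 h2 => by omega⟩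
  | succ k ih =>
    intro r c h
    constructor
    · intro h1 h2
      rcases Nat.lt_or_ge c n with h3 | h3
      · by_cases hb : IsBlack Δ r c
        · obtain ⟨i, hi⟩ := (ih r (c + 1) (by omega)).1 h1 h3
          exact ⟨i, by rw [hi, followPipe, if_pos hb]⟩
        · obtain ⟨i, hi⟩ := (ih (r + 1) c (by omega)).2 h1 h3
          exact ⟨i, by rw [hi, followPipe, if_neg hb]⟩
      · obtain rfl : c = n := le_antisymm h2 h3
        refine ⟨(1, ⟨c - 1 - r, by omega⟩), ?_⟩
        have : c - 1 - (c - 1 - r) = r := by omega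
        simp [pipeEnd, this]
    · intro h1 h2
      rcases Nat.lt_or_ge r n with h3 | h3
      · by_cases hb : IsBlack Δ r c
        · obtain ⟨i, hi⟩ := (ih (r + 1) c (by omega)).2 h3 h2
          exact ⟨i, by rw [hi, followPipe, if_pos hb]⟩
        · obtain ⟨i, hi⟩ := (ih r (c + 1) (by omega)).1 h3 h2
          exact ⟨i, by rw [hi, followPipe, if_neg hb]⟩
      · obtain rfl : r = n := le_antisymm h1 h3
        refine ⟨(-1, ⟨r - 1 - c, by omega⟩), ?_⟩
        have : r - 1 - (r - 1 - c) = c := by omega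
        have h4 : (-1 : ℤˣ) ≠ 1 := by decide
        simp [pipeEnd, this, h4]

theorem pipeEnd_bijective {n : ℕ} (Δ : Finset (Box n)) : Function.Bijective (pipeEnd Δ) := by
  refine Function.Surjective.bijective_of_finite fun y => ?_
  obtain ⟨e, k⟩ := y
  have hn : 0 < n := Fin.pos k
  have hk : n - 1 - (n - 1 - (k : ℕ)) = k := by omega
  have key := followPipe_mem_range hn Δ (2 * n)
  rcases Int.units_eq_one_or e with rfl | rfl
  · obtain ⟨i, hi⟩ := (key (n - 1 - k) 0 (by omega)).1 (by omega) (by omega)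
    exact ⟨i, by rw [hi, followPipe]; simp [exitLabel, hk]⟩
  · obtain ⟨i, hi⟩ := (key 0 (n - 1 - k) (by omega)).2 (by omega) (by omega)
    exact ⟨i, by rw [hi, followPipe]; simp [exitLabel, hk]⟩

/-- The permutation `τ_Δ` of `[n] ∪ -[n]` that the pipes define. -/
noncomputable def pipePerm {n : ℕ} (Δ : Finset (Box n)) : Equiv.Perm (SignedIndex n) :=
  Equiv.ofBijective (pipeEnd Δ) (pipeEnd_bijective Δ)

/-! ### Types of cycles -/

/-- `signedWord 1 [R_1, R_2, R_3, …]` is the concatenation of `R_1, -R_2, R_3, …`, and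
`signedWord (-1) [R_1, R_2, R_3, …]` is the concatenation of `-R_1, R_2, -R_3, …`. -/
def signedWord {n : ℕ} : ℤˣ → List (List (Fin n)) → List (SignedIndex n)
  | _, [] => []
  | e, R :: Rs => R.map (fun i => (e, i)) ++ signedWord (-e) Rs

/-- `R_1, R_2, …` are nonempty, increasing and pairwise disjoint sequences. -/
def IsBlockList {n : ℕ} (Rs : List (List (Fin n))) : Prop :=
  (∀ R ∈ Rs, R ≠ [] ∧ R.Pairwise (· < ·)) ∧ Rs.flatten.Nodup

/-- `C` is the pair of cycles `(R_1, -R_2, …, -R_{2m})`, `(-R_1, R_2, …, R_{2m})` of `σ`, for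
some `m ≥ 1`. -/
def IsTypeB {n : ℕ} (σ : Equiv.Perm (SignedIndex n)) (Rs : List (List (Fin n)))
    (C : Finset (Equiv.Perm (SignedIndex n))) : Prop :=
  IsBlockList Rs ∧ (∃ m, 1 ≤ m ∧ Rs.length = 2 * m) ∧
    C = {(signedWord 1 Rs).formPerm, (signedWord (-1) Rs).formPerm} ∧ C ⊆ σ.cycleFactorsFinset

/-- `C` consists of the single cycle `(R_1, -R_2, …, R_{2m-1}, -R_1, R_2, …, -R_{2m-1})` of `σ`,
for some `m ≥ 1`. -/
def IsTypeC {n : ℕ} (σ : Equiv.Perm (SignedIndex n)) (Rs : List (List (Fin n)))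
    (C : Finset (Equiv.Perm (SignedIndex n))) : Prop :=
  IsBlockList Rs ∧ (∃ m, 1 ≤ m ∧ Rs.length = 2 * m - 1) ∧
    C = {(signedWord 1 Rs ++ signedWord (-1) Rs).formPerm} ∧ C ⊆ σ.cycleFactorsFinset

/-- The pairs of cycles of type (b) with `∑ |R_i|` even. -/
def evenTypeB {n : ℕ} (σ : Equiv.Perm (SignedIndex n)) :
    Set (Finset (Equiv.Perm (SignedIndex n))) :=
  {C | ∃ Rs, IsTypeB σ Rs C ∧ Even (Rs.map List.length).sum}

/-- The cycles of type (c) with `∑ |R_i|` odd. -/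
def oddTypeC {n : ℕ} (σ : Equiv.Perm (SignedIndex n)) :
    Set (Finset (Equiv.Perm (SignedIndex n))) :=
  {C | ∃ Rs, IsTypeC σ Rs C ∧ Odd (Rs.map List.length).sum}

section Vectors

variable (𝕜 : Type*) [Field 𝕜] {n : ℕ}

/-- The `n × n` matrix with entry `1` at `(i, j)` if `σ(i) = j`, `-1` if `σ(i) = -j`, and `0`
otherwise. -/
def signedMatrix (σ : Equiv.Perm (SignedIndex n)) : Matrix (Fin n) (Fin n) 𝕜 :=
  Matrix.of fun i j => if σ (1, i) = (1, j) then 1 else if σ (1, i) = (-1, j) then -1 else 0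

/-- The vector `v` that is attached to a cycle or a pair of cycles with the blocks `R_1, R_2, …`:
if `a` is the first entry of `R_1` and `r = ∑ |R_i|`, then for `0 ≤ j < r` the component of `v` at
`|σ^j(a)|` is `(-1)^j ∏_{l < j} P[|σ^l(a)|, |σ^{l+1}(a)|]`, with `P` the signed matrix of `σ`, and
all other components are `0`. -/
def cycleVector (σ : Equiv.Perm (SignedIndex n)) (Rs : List (List (Fin n))) : Fin n → 𝕜 :=
  match Rs.flatten with
  | [] => 0
  | a :: _ => ∑ j ∈ Finset.range (Rs.map List.length).sum,
      Pi.single ((σ ^ j) (1, a)).2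
        ((-1) ^ j * ∏ l ∈ Finset.range j,
          signedMatrix 𝕜 σ ((σ ^ l) (1, a)).2 ((σ ^ (l + 1)) (1, a)).2)

/-- `ker (w^Δ + w)`. -/
noncomputable def kernel (Δ : Finset (Box n)) : Submodule 𝕜 (Fin n → 𝕜) :=
  LinearMap.ker ((subElt 𝕜 Δ : (Fin n → 𝕜) →ₗ[𝕜] (Fin n → 𝕜)) + (maxElt 𝕜 n).toLinearMap)

end Vectors

end TypeB

/-! Put `T = w^Δ w⁻¹`. Since `w^Δ + w = (T + 1) w`, the map `w` carries the kernel onto the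
`(-1)`-eigenspace of `T`. When the letters of `w^Δ` act one after another, last box first, a basis
vector moves through the tableau as a pipe moves through the grid, and the black diagonal squares,
which hold `s_n`, supply the signs (`signedVec_followPipe`). The all-black diagram yields `w`;
dividing by it makes `T` the signed permutation of the `±ε_k` given by `τ`
(`subElt_maxElt_symm_signedVec`).

A `(-1)`-eigenvector of `T` is thus an odd function `f` on `[n] ∪ -[n]` with `f ∘ τ = -f`. Let `r`
be the first return time of `|a|`. If `f(a) ≠ 0`, then `r` is even when `τ^r(a) = a` and odd when
`τ^r(a) = -a`. Such orbits split into increasing blocks of constant sign because pipes never run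
downwards (`le_pipeEnd`), which gives exactly the types (b) and (c) (`exists_isEvenBOrOddC`).
Conversely, the alternating sum along such an orbit is an eigenvector
(`IsEvenBOrOddC.apply_cycleVector`). Different orbits have disjoint supports and one coordinate
determines `f` on an orbit, so these vectors form a basis (`exists_basis_kernel`). -/

namespace TypeB

/-! ### The action of the subword products on basis vectors, and pipes. -/

section Action

variable (𝕜 : Type*) [Field 𝕜] {n : ℕ}

/-- The element `-x` of `[n] ∪ -[n]`. -/
def negIndex (x : SignedIndex n) : SignedIndex n := (-x.1, x.2)

@[simp] theorem negIndex_negIndex (x : SignedIndex n) : negIndex (negIndex x) = x := by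
  simp [negIndex]

/-- The vector `±ε_k` that belongs to `±k`. -/
def signedVec (x : SignedIndex n) : Fin n → 𝕜 := Pi.single x.2 ((x.1 : ℤ) : 𝕜)

theorem signedVec_negIndex (x : SignedIndex n) :
    signedVec 𝕜 (negIndex x) = -signedVec 𝕜 x := by
  simp [signedVec, negIndex, Pi.single_neg]

/-- The basis vector with index `m`, counted from `0`, and `0` if `m` is out of range. -/
def stdVec (n m : ℕ) : Fin n → 𝕜 := fun k => if (k : ℕ) = m then 1 else 0

theorem signedVec_one (k : Fin n) : signedVec 𝕜 (1, k) = stdVec 𝕜 n k := by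
  ext j
  simp [signedVec, stdVec, Pi.single_apply, Fin.ext_iff]

theorem simpleReflection_stdVec_of_ne (i : Fin n) {m : ℕ} (h1 : m ≠ i) (h2 : m ≠ i + 1) :
    simpleReflection 𝕜 i (stdVec 𝕜 n m) = stdVec 𝕜 n m := by
  have h : simpleCoroot 𝕜 i (stdVec 𝕜 n m) = 0 := by
    unfold simpleCoroot
    split_ifs <;> simp [stdVec, h1.symm, h2.symm]
  simp [simpleReflection, Module.reflection_apply, h]

theorem simpleReflection_stdVec_self (i : Fin n) (hi : (i : ℕ) + 1 < n) :
    simpleReflection 𝕜 i (stdVec 𝕜 n i) = stdVec 𝕜 n (i + 1) := by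
  have h : simpleCoroot 𝕜 i (stdVec 𝕜 n i) = 1 := by
    simp [simpleCoroot, hi, stdVec]
  ext j
  rw [simpleReflection, Module.reflection_apply, h]
  simp only [simpleRoot, hi, dif_pos, one_smul, Pi.sub_apply, stdVec, Pi.single_apply, Fin.ext_iff]
  ring

theorem simpleReflection_stdVec_succ (i : Fin n) (hi : (i : ℕ) + 1 < n) :
    simpleReflection 𝕜 i (stdVec 𝕜 n (i + 1)) = stdVec 𝕜 n i := by
  rw [← simpleReflection_stdVec_self 𝕜 i hi]
  exact Module.involutive_reflection (simpleCoroot_simpleRoot 𝕜 i) _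

theorem simpleReflection_stdVec_last (i : Fin n) (hi : (i : ℕ) + 1 = n) :
    simpleReflection 𝕜 i (stdVec 𝕜 n i) = -stdVec 𝕜 n i := by
  have h : simpleCoroot 𝕜 i (stdVec 𝕜 n i) = 2 := by
    simp [simpleCoroot, hi, stdVec]
  ext j
  rw [simpleReflection, Module.reflection_apply, h]
  simp only [simpleRoot, hi, lt_irrefl, dif_neg, not_false_eq_true, Pi.sub_apply, Pi.smul_apply,
    Pi.neg_apply, stdVec, Pi.single_apply, Fin.ext_iff, smul_eq_mul]
  ring

variable (Δ : Finset (Box n))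

theorem isBlack_comm {r c : ℕ} : IsBlack Δ r c ↔ IsBlack Δ c r := by
  simp only [IsBlack, or_comm]

theorem isBlack_box (b : Box n) : IsBlack Δ b.1 b.2 ↔ b ∈ Δ := by
  constructor
  · rintro ⟨⟨r', c'⟩, hb, h⟩
    obtain ⟨r, c⟩ := b
    have h1 := c.isLt
    have h2 := c'.isLt
    simp only at h h1 h2
    have h3 : r' = r := by ext; omega
    subst h3
    have h4 : c' = c := by ext; omega
    rwa [← h4]
  · exact fun h => ⟨b, h, Or.inl ⟨rfl, rfl⟩⟩

/-- The reflection of the square in row `r` and column `c`, or the identity if it is white. -/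
noncomputable def boxRefl (r c : ℕ) : (Fin n → 𝕜) ≃ₗ[𝕜] (Fin n → 𝕜) :=
  if h : n - 1 - r + c < n ∧ IsBlack Δ r c then simpleReflection 𝕜 ⟨_, h.1⟩ else 1

/-- The product over the first `c` squares of the row `r`. -/
noncomputable def rowProd (r c : ℕ) : (Fin n → 𝕜) ≃ₗ[𝕜] (Fin n → 𝕜) :=
  ((List.range c).map (boxRefl 𝕜 Δ r)).prod

/-- The product over the first `r` rows of the tableau. -/
noncomputable def rowsProd (r : ℕ) : (Fin n → 𝕜) ≃ₗ[𝕜] (Fin n → 𝕜) :=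
  ((List.range r).map fun i => rowProd 𝕜 Δ i (i + 1)).prod

theorem rowProd_succ (r c : ℕ) :
    rowProd 𝕜 Δ r (c + 1) = rowProd 𝕜 Δ r c * boxRefl 𝕜 Δ r c := by
  simp [rowProd, List.range_succ]

theorem rowsProd_succ (r : ℕ) :
    rowsProd 𝕜 Δ (r + 1) = rowsProd 𝕜 Δ r * rowProd 𝕜 Δ r (r + 1) := by
  simp [rowsProd, List.range_succ]

theorem subElt_eq_rowsProd : subElt 𝕜 Δ = rowsProd 𝕜 Δ n := by
  rw [subElt, boxes, List.map_flatMap, List.flatMap_def, List.prod_flatten, rowsProd,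
    ← List.map_coe_finRange_eq_range, List.map_map, List.map_map]
  congr 1
  refine List.map_congr_left fun r _ => ?_
  simp only [Function.comp_apply, rowProd]
  rw [← List.map_coe_finRange_eq_range, List.map_map, List.map_map]
  congr 1
  refine List.map_congr_left fun c _ => ?_
  simp only [Function.comp_apply, subReflection, boxRefl]
  have h := isBlack_box Δ ⟨r, c⟩
  have hlt : n - 1 - (r : ℕ) + (c : ℕ) < n := (boxIndex (⟨r, c⟩ : Box n)).isLt
  simp only at h
  by_cases hb : (⟨r, c⟩ : Box n) ∈ Δ
  · rw [if_pos hb, dif_pos ⟨hlt, h.2 hb⟩]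
    rfl
  · rw [if_neg hb, dif_neg fun h' => hb (h.1 h'.2)]

variable {Δ}

theorem boxRefl_of_not_isBlack {r c : ℕ} (h : ¬IsBlack Δ r c) : boxRefl 𝕜 Δ r c = 1 :=
  dif_neg fun h' => h h'.2

theorem boxRefl_of_isBlack {r c : ℕ} (h : IsBlack Δ r c) (hlt : n - 1 - r + c < n) :
    boxRefl 𝕜 Δ r c = simpleReflection 𝕜 ⟨n - 1 - r + c, hlt⟩ :=
  dif_pos ⟨hlt, h⟩

variable (Δ)

theorem boxRefl_stdVec_of_ne {r c m : ℕ} (h1 : m ≠ n - 1 - r + c) (h2 : m ≠ n - 1 - r + c + 1) :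
    boxRefl 𝕜 Δ r c (stdVec 𝕜 n m) = stdVec 𝕜 n m := by
  unfold boxRefl
  split_ifs with h
  · exact simpleReflection_stdVec_of_ne 𝕜 _ h1 h2
  · rfl

theorem rowProd_stdVec_of_lt {r m : ℕ} (c : ℕ) (h : n - 1 - r + c < m) :
    rowProd 𝕜 Δ r c (stdVec 𝕜 n m) = stdVec 𝕜 n m := by
  induction c with
  | zero => rfl
  | succ c ih =>
    rw [rowProd_succ, LinearEquiv.mul_apply, boxRefl_stdVec_of_ne _ _ (by omega) (by omega),
      ih (by omega)]

theorem rowProd_stdVec_of_gt {r m : ℕ} (c : ℕ) (h : m < n - 1 - r) :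
    rowProd 𝕜 Δ r c (stdVec 𝕜 n m) = stdVec 𝕜 n m := by
  induction c with
  | zero => rfl
  | succ c ih =>
    rw [rowProd_succ, LinearEquiv.mul_apply, boxRefl_stdVec_of_ne _ _ (by omega) (by omega), ih]

/-- The squares to the right of column `c` hold reflections that move only larger indices. -/
theorem rowProd_stdVec_of_le {r c d : ℕ} (h : c + 1 ≤ d) :
    rowProd 𝕜 Δ r d (stdVec 𝕜 n (n - 1 - r + c)) =
      rowProd 𝕜 Δ r (c + 1) (stdVec 𝕜 n (n - 1 - r + c)) := by
  induction d, h using Nat.le_induction with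
  | base => rfl
  | succ d hd ih =>
    rw [rowProd_succ, LinearEquiv.mul_apply, boxRefl_stdVec_of_ne _ _ (by omega) (by omega), ih]

theorem rowsProd_stdVec_of_lt {m : ℕ} (r : ℕ) (h : m + r < n) :
    rowsProd 𝕜 Δ r (stdVec 𝕜 n m) = stdVec 𝕜 n m := by
  induction r with
  | zero => rfl
  | succ r ih =>
    rw [rowsProd_succ, LinearEquiv.mul_apply, rowProd_stdVec_of_gt _ _ _ (by omega),
      ih (by omega)]

variable (hn : 0 < n)

/-- The colouring is symmetric in the diagonal; the reflection swaps the two headings and the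
opposite labels of the left and top sides. -/
theorem followPipe_comm (k : ℕ) : ∀ r c : ℕ, r + c ≤ k →
    followPipe hn Δ .up r c = negIndex (followPipe hn Δ .left c r) := by
  induction k with
  | zero =>
    intro r c h
    obtain ⟨rfl, rfl⟩ : r = 0 ∧ c = 0 := by omega
    simp [followPipe, exitLabel, negIndex]
  | succ k ih =>
    intro r c h
    rcases r with - | r
    · simp [followPipe, exitLabel, negIndex]
    · rw [followPipe, followPipe]
      simp only [isBlack_comm Δ (r := c)]
      split_ifs
      · exact ih r c (by omega)
      · rw [ih c r (by omega), negIndex_negIndex]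

theorem pipeEnd_negIndex (x : SignedIndex n) :
    pipeEnd Δ (negIndex x) = negIndex (pipeEnd Δ x) := by
  obtain ⟨e, k⟩ := x
  have h4 : (-1 : ℤˣ) ≠ 1 := by decide
  rcases Int.units_eq_one_or e with rfl | rfl
  · simp only [pipeEnd, negIndex, h4, if_false, if_true]
    exact followPipe_comm Δ _ _ _ _ le_rfl
  · simp only [pipeEnd, negIndex, h4, if_false, if_true, neg_neg]
    rw [followPipe_comm Δ _ _ _ _ le_rfl]
    simp [negIndex]

/-- A pipe never runs downwards, and row labels grow upwards. -/
theorem le_followPipe (d : Heading) (r c : ℕ) (h : (followPipe hn Δ d r c).1 = 1) :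
    n - 1 - r ≤ (followPipe hn Δ d r c).2 := by
  have h4 : (-1 : ℤˣ) ≠ 1 := by decide
  fun_induction followPipe hn Δ d r c with
  | case1 r => simp [exitLabel]
  | case2 r c hb ih => exact ih h
  | case3 r c hb ih => exact ih h
  | case4 c => simp [exitLabel, h4] at h
  | case5 r c hb ih => have := ih h; omega
  | case6 r c hb ih => have := ih h; omega

theorem le_pipeEnd_of_pos {i : Fin n} (h : (pipeEnd Δ (1, i)).1 = 1) :
    i ≤ (pipeEnd Δ (1, i)).2 := by
  simp only [pipeEnd, if_true] at h ⊢
  have := le_followPipe Δ _ _ _ _ h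
  simp only [Fin.le_def]
  omega

theorem le_pipeEnd (x : SignedIndex n) (h : (pipeEnd Δ x).1 = x.1) : x.2 ≤ (pipeEnd Δ x).2 := by
  obtain ⟨e, i⟩ := x
  rcases Int.units_eq_one_or e with rfl | rfl
  · exact le_pipeEnd_of_pos Δ h
  · have h1 := pipeEnd_negIndex Δ (1, i)
    simp only [negIndex] at h1
    rw [h1] at h ⊢
    exact le_pipeEnd_of_pos Δ (neg_injective h)

/-- The invariant linking words and pipes: the letters still to be applied are the boxes before the
current position, and the index of the moving basis vector encodes that position. A black square
shifts the index just as the pipe goes straight; at a white square the same index is reread with the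
other heading. Only the lower triangle is needed, by the symmetry. -/
theorem signedVec_followPipe (k : ℕ) : ∀ r c : ℕ, r + c ≤ k → c ≤ r →
    (r < n → rowsProd 𝕜 Δ r (rowProd 𝕜 Δ r c (stdVec 𝕜 n (n - 1 - r + c))) =
      signedVec 𝕜 (followPipe hn Δ .left r c)) ∧
    (r ≤ n → c < r → rowsProd 𝕜 Δ r (stdVec 𝕜 n (n - r + c)) =
      signedVec 𝕜 (followPipe hn Δ .up r c)) := by
  have exit (r : ℕ) (hr : r < n) :
      rowsProd 𝕜 Δ r (rowProd 𝕜 Δ r 0 (stdVec 𝕜 n (n - 1 - r + 0))) =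
        signedVec 𝕜 (followPipe hn Δ .left r 0) := by
    rw [followPipe, exitLabel, signedVec_one]
    exact rowsProd_stdVec_of_lt _ _ _ (by omega)
  induction k with
  | zero =>
    intro r c h hc
    obtain ⟨rfl, rfl⟩ : r = 0 ∧ c = 0 := by omega
    exact ⟨exit 0, fun _ h => absurd h (lt_irrefl _)⟩
  | succ k ih =>
    intro r c h hc
    constructor
    · intro hr
      rcases c with - | c
      · exact exit r hr
      rw [followPipe, rowProd_succ, LinearEquiv.mul_apply]
      by_cases hb : IsBlack Δ r c
      · have hlt : n - 1 - r + c < n := by omega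
        rw [if_pos hb, boxRefl_of_isBlack 𝕜 hb hlt,
          show n - 1 - r + (c + 1) = ((⟨n - 1 - r + c, hlt⟩ : Fin n) : ℕ) + 1 from rfl,
          simpleReflection_stdVec_succ _ _ (by simp only; omega)]
        exact (ih r c (by omega) (by omega)).1 hr
      · rw [if_neg hb, boxRefl_of_not_isBlack 𝕜 hb, LinearEquiv.coe_one, id_eq,
          rowProd_stdVec_of_lt _ _ _ (by omega),
          ← (ih r c (by omega) (by omega)).2 hr.le (by omega)]
        congr 2
        omega
    · intro hr hcr
      obtain ⟨r, rfl⟩ : ∃ r', r = r' + 1 := ⟨r - 1, by omega⟩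
      rw [followPipe, rowsProd_succ, LinearEquiv.mul_apply,
        show n - (r + 1) + c = n - 1 - r + c by omega,
        rowProd_stdVec_of_le _ _ (by omega), rowProd_succ, LinearEquiv.mul_apply]
      have hlt : n - 1 - r + c < n := by omega
      by_cases hb : IsBlack Δ r c
      · rw [if_pos hb, boxRefl_of_isBlack 𝕜 hb hlt]
        rcases Nat.lt_or_ge c r with hc | hc
        · rw [simpleReflection_stdVec_self 𝕜 ⟨n - 1 - r + c, hlt⟩ (by simp only; omega),
            ← (ih r c (by omega) hc.le).2 (by omega) hc,
            rowProd_stdVec_of_lt _ _ _ (by simp only; omega)]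
          congr 2
          simp only
          omega
        -- Going up through a black diagonal square, the pipe enters the upper triangle. It is
        -- replaced by its mirror image running left, and the sign from `s_n` matches the negation
        -- of the label.
        · obtain rfl : c = r := by omega
          rw [simpleReflection_stdVec_last 𝕜 ⟨n - 1 - c + c, hlt⟩ (by simp only; omega),
            map_neg, map_neg, (ih c c (by omega) le_rfl).1 (by omega),
            followPipe_comm Δ hn _ _ _ le_rfl, signedVec_negIndex]
      · rw [if_neg hb, boxRefl_of_not_isBlack 𝕜 hb, LinearEquiv.coe_one, id_eq]
        exact (ih r c (by omega) (by omega)).1 (by omega)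

/-- The full product corresponds to pipes that start at the bottom; column labels count from the
right and indices from the left, hence `rev`. -/
theorem subElt_signedVec (x : SignedIndex n) :
    subElt 𝕜 Δ (signedVec 𝕜 (-x.1, x.2.rev)) = signedVec 𝕜 (pipeEnd Δ x) := by
  obtain ⟨e, k⟩ := x
  have key : subElt 𝕜 Δ (signedVec 𝕜 (1, k.rev)) = signedVec 𝕜 (pipeEnd Δ (-1, k)) := by
    have h4 : (-1 : ℤˣ) ≠ 1 := by decide
    simp only [pipeEnd, h4, if_false]
    rw [signedVec_one, subElt_eq_rowsProd,
      ← (signedVec_followPipe 𝕜 Δ (Fin.pos k) _ n _ le_rfl (by omega)).2 le_rfl (by omega)]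
    congr 2
    simp [Fin.val_rev]
    omega
  rcases Int.units_eq_one_or e with rfl | rfl
  · have h1 := signedVec_negIndex 𝕜 ((1, k.rev) : SignedIndex n)
    have h2 := pipeEnd_negIndex Δ (-1, k)
    simp only [negIndex, neg_neg] at h1 h2
    simp only [h1, map_neg, key, h2]
    exact (signedVec_negIndex 𝕜 (pipeEnd Δ (-1, k))).symm
  · simpa using key

theorem isBlack_univ {r c : ℕ} (hr : r < n) (hc : c < n) :
    IsBlack (Finset.univ : Finset (Box n)) r c := by
  rcases le_total c r with h | h
  · exact ⟨⟨⟨r, hr⟩, ⟨c, Nat.lt_succ_of_le h⟩⟩, Finset.mem_univ _, Or.inl ⟨rfl, rfl⟩⟩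
  · exact ⟨⟨⟨c, hc⟩, ⟨r, Nat.lt_succ_of_le h⟩⟩, Finset.mem_univ _, Or.inr ⟨rfl, rfl⟩⟩

theorem followPipe_univ {r : ℕ} (hr : r < n) (c : ℕ) (hc : c ≤ n) :
    followPipe hn Finset.univ .left r c = (1, ⟨n - 1 - r, by omega⟩) := by
  induction c with
  | zero => simp [followPipe, exitLabel]
  | succ c ih => rw [followPipe, if_pos (isBlack_univ hr hc), ih (by omega)]

theorem pipeEnd_univ (x : SignedIndex n) : pipeEnd Finset.univ x = x := by
  have key (k : Fin n) : pipeEnd Finset.univ (1, k) = (1, k) := by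
    simp only [pipeEnd, if_true]
    rw [followPipe_univ _ (by omega) _ le_rfl]
    ext <;> simp
    omega
  obtain ⟨e, k⟩ := x
  rcases Int.units_eq_one_or e with rfl | rfl
  · exact key k
  · have := pipeEnd_negIndex Finset.univ (1, k)
    rwa [key] at this

theorem maxElt_eq_subElt : maxElt 𝕜 n = subElt 𝕜 Finset.univ := by
  have h : subReflection 𝕜 (Finset.univ : Finset (Box n)) =
      fun b => simpleReflection 𝕜 (boxIndex b) := by
    ext1 b
    simp [subReflection]
  rw [maxElt, subElt, h]

theorem maxElt_signedVec (x : SignedIndex n) :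
    maxElt 𝕜 n (signedVec 𝕜 (-x.1, x.2.rev)) = signedVec 𝕜 x := by
  rw [maxElt_eq_subElt, subElt_signedVec, pipeEnd_univ]

/-- For the all-black diagram every pipe is straight, so `w` performs only the relabelling by sign
and `rev`, and its inverse cancels it. -/
theorem subElt_maxElt_symm_signedVec (x : SignedIndex n) :
    subElt 𝕜 Δ ((maxElt 𝕜 n).symm (signedVec 𝕜 x)) = signedVec 𝕜 (pipePerm Δ x) := by
  rw [(maxElt 𝕜 n).symm_apply_eq.2 (maxElt_signedVec 𝕜 x).symm, subElt_signedVec]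
  rfl

end Action


/-! ### Words of cycles -/

section Words

variable {n : ℕ}

theorem map_snd_signedWord (Rs : List (List (Fin n))) :
    ∀ e : ℤˣ, (signedWord e Rs).map Prod.snd = Rs.flatten := by
  induction Rs with
  | nil => intro e; rfl
  | cons R Rs ih => intro e; simp [signedWord, ih, Function.comp_def]

theorem signedWord_neg (Rs : List (List (Fin n))) :
    ∀ e : ℤˣ, signedWord (-e) Rs = (signedWord e Rs).map negIndex := by
  induction Rs with
  | nil => intro e; rfl
  | cons R Rs ih => intro e; simp [signedWord, ih, negIndex, Function.comp_def]

theorem length_signedWord (e : ℤˣ) (Rs : List (List (Fin n))) :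
    (signedWord e Rs).length = (Rs.map List.length).sum := by
  rw [← List.length_map (f := Prod.snd), map_snd_signedWord, List.length_flatten]

theorem negIndex_injective : Function.Injective (negIndex : SignedIndex n → SignedIndex n) :=
  Function.LeftInverse.injective negIndex_negIndex

theorem negIndex_ne (x : SignedIndex n) : negIndex x ≠ x := fun h =>
  units_ne_neg_self x.1 (congrArg Prod.fst h).symm

theorem eq_or_eq_negIndex {x y : SignedIndex n} (h : x.2 = y.2) : x = y ∨ x = negIndex y := by
  obtain ⟨e, k⟩ := x
  obtain ⟨e', k'⟩ := y
  obtain rfl : k = k' := h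
  rcases eq_or_ne e e' with rfl | h
  · exact Or.inl rfl
  · exact Or.inr (by simp [negIndex, Int.units_ne_iff_eq_neg.1 h])

theorem negIndex_notMem {l : List (SignedIndex n)} (h : (l.map Prod.snd).Nodup)
    {x : SignedIndex n} (hx : x ∈ l) : negIndex x ∉ l := fun hx' =>
  negIndex_ne x (List.inj_on_of_nodup_map h hx' hx rfl)

theorem nodup_append_map_negIndex {l : List (SignedIndex n)} (h : (l.map Prod.snd).Nodup) :
    (l ++ l.map negIndex).Nodup := by
  refine List.Nodup.append (List.Nodup.of_map _ h)
    ((List.Nodup.of_map _ h).map negIndex_injective) fun x hx hx' => ?_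
  obtain ⟨y, hy, rfl⟩ := List.mem_map.1 hx'
  exact negIndex_notMem h hy hx

/-- A word in which the entries increase as long as the sign is constant splits into blocks. -/
theorem exists_signedWord_eq (t : List (SignedIndex n)) : ∀ x : SignedIndex n,
    (x :: t).IsChain (fun y z => y.1 = z.1 → y.2 < z.2) →
    ∃ (R : List (Fin n)) (Rs : List (List (Fin n))),
      (∀ S ∈ (x.2 :: R) :: Rs, S ≠ [] ∧ S.Pairwise (· < ·)) ∧
      signedWord x.1 ((x.2 :: R) :: Rs) = x :: t ∧
      ((x :: t).getLast (List.cons_ne_nil _ _)).1 = x.1 * (-1) ^ Rs.length := by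
  -- The third conjunct carries the parity of the number of blocks, which later separates (b) from
  -- (c).
  induction t with
  | nil => intro x _; exact ⟨[], [], by simp, by simp [signedWord], by simp⟩
  | cons y t ih =>
    intro x h
    rw [List.isChain_cons_cons] at h
    obtain ⟨R, Rs, h1, h2, h3⟩ := ih y h.2
    rw [List.getLast_cons (List.cons_ne_nil _ _), h3]
    -- An equal sign prolongs the first block; a change of sign opens a new one.
    by_cases hxy : x.1 = y.1
    · refine ⟨y.2 :: R, Rs, ?_, ?_, by rw [hxy]⟩
      · intro S hS
        rcases List.mem_cons.1 hS with rfl | hS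
        · refine ⟨List.cons_ne_nil _ _, ?_⟩
          have h4 := (h1 _ List.mem_cons_self).2
          have h5 := h.1 hxy
          refine List.pairwise_cons.2 ⟨fun z hz => ?_, h4⟩
          rcases List.mem_cons.1 hz with rfl | hz
          · exact h5
          · exact h5.trans ((List.pairwise_cons.1 h4).1 z hz)
        · exact h1 S (List.mem_cons_of_mem _ hS)
      · rw [← h2, ← hxy]
        simp [signedWord]
    · have hxy' : y.1 = -x.1 := Int.units_ne_iff_eq_neg.1 (Ne.symm hxy)
      refine ⟨[], (y.2 :: R) :: Rs, ?_, ?_, ?_⟩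
      · intro S hS
        rcases List.mem_cons.1 hS with rfl | hS
        · simp
        · exact h1 S hS
      · rw [← h2, hxy']
        simp [signedWord]
      · rw [hxy', List.length_cons, pow_succ]
        simp

end Words

/-! ### Cycle factors given by lists. -/

section Cycles

open Equiv.Perm

variable {α : Type*} [DecidableEq α] [Fintype α] {σ : Equiv.Perm α}

theorem two_le_length_of_formPerm_mem {l : List α} (hl : l.formPerm ∈ σ.cycleFactorsFinset) :
    2 ≤ l.length := by
  have h := (mem_cycleFactorsFinset_iff.1 hl).1.ne_one
  rcases l with - | ⟨x, - | ⟨y, l⟩⟩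
  · simp at h
  · simp at h
  · simp

theorem support_of_formPerm_mem {l : List α} (hd : l.Nodup)
    (hl : l.formPerm ∈ σ.cycleFactorsFinset) : l.formPerm.support = l.toFinset := by
  refine List.support_formPerm_of_nodup l hd fun x hx => ?_
  have := two_le_length_of_formPerm_mem hl
  simp [hx] at this

theorem pow_apply_of_formPerm_mem {x : α} {t : List α} (hd : (x :: t).Nodup)
    (hl : (x :: t).formPerm ∈ σ.cycleFactorsFinset) (j : ℕ) :
    (σ ^ j) x = (x :: t)[j % (x :: t).length]'(Nat.mod_lt _ (by simp)) := by
  induction j with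
  | zero => simp
  | succ j ih =>
    have hj : j % (x :: t).length < (x :: t).length := Nat.mod_lt _ (by simp)
    have h1 := List.formPerm_apply_getElem _ hd _ hj
    rw [(mem_cycleFactorsFinset_iff.1 hl).2 _
      (by rw [support_of_formPerm_mem hd hl]; simp only [List.mem_toFinset, List.getElem_mem])]
      at h1
    rw [pow_succ', mul_apply, ih, h1]
    simp only [Nat.mod_add_mod]

theorem formPerm_mem_cycleFactorsFinset {x : α} {r : ℕ} (hr : 2 ≤ r)
    (hd : ((List.range r).map fun j => (σ ^ j) x).Nodup) (hx : (σ ^ r) x = x) :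
    ((List.range r).map fun j => (σ ^ j) x).formPerm ∈ σ.cycleFactorsFinset := by
  rw [mem_cycleFactorsFinset_iff]
  refine ⟨List.isCycle_formPerm hd (by simpa using hr), fun y hy => ?_⟩
  have hy' := List.mem_toFinset.1 (List.support_formPerm_le _ hy)
  obtain ⟨i, hi, rfl⟩ := List.getElem_of_mem hy'
  rw [List.formPerm_apply_getElem _ hd]
  simp only [List.length_map, List.length_range] at hi
  simp only [List.getElem_map, List.getElem_range, List.length_map, List.length_range]
  rw [← mul_apply, ← pow_succ']
  -- The second case is the last entry, where the cycle closes up by `hx`.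
  rcases Nat.lt_or_ge (i + 1) r with h | h
  · rw [Nat.mod_eq_of_lt h]
  · obtain rfl : r = i + 1 := by omega
    rw [Nat.mod_self, hx]
    simp

end Cycles

/-! ### Cycles of the types (b) and (c) -/

section CycleTypes

open Equiv.Perm

variable {n : ℕ} {σ : Equiv.Perm (SignedIndex n)} {Rs : List (List (Fin n))}
  {C : Finset (Equiv.Perm (SignedIndex n))}

theorem nodup_map_snd_signedWord (h : IsBlockList Rs) (e : ℤˣ) :
    ((signedWord e Rs).map Prod.snd).Nodup := by
  rw [map_snd_signedWord]
  exact h.2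

theorem exists_mem_signedWord (e : ℤˣ) {k : Fin n} (hk : k ∈ Rs.flatten) :
    ∃ e', (e', k) ∈ signedWord e Rs ∧ (-e', k) ∈ signedWord (-e) Rs := by
  rw [← map_snd_signedWord Rs e] at hk
  obtain ⟨⟨e', k⟩, hx, rfl⟩ := List.mem_map.1 hk
  refine ⟨e', hx, ?_⟩
  rw [signedWord_neg]
  exact List.mem_map_of_mem (f := negIndex) hx

theorem IsTypeB.mem (h : IsTypeB σ Rs C) (e : ℤˣ) :
    (signedWord e Rs).formPerm ∈ C := by
  rw [h.2.2.1]
  rcases Int.units_eq_one_or e with rfl | rfl <;> simp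

theorem IsTypeB.support (h : IsTypeB σ Rs C) (e : ℤˣ) :
    (signedWord e Rs).formPerm.support = (signedWord e Rs).toFinset :=
  support_of_formPerm_mem (List.Nodup.of_map _ (nodup_map_snd_signedWord h.1 e))
    (h.2.2.2 (h.mem e))

theorem IsTypeC.nodup (h : IsTypeC σ Rs C) : (signedWord 1 Rs ++ signedWord (-1) Rs).Nodup := by
  rw [signedWord_neg]
  exact nodup_append_map_negIndex (nodup_map_snd_signedWord h.1 1)

theorem IsTypeC.mem (h : IsTypeC σ Rs C) :
    (signedWord 1 Rs ++ signedWord (-1) Rs).formPerm ∈ C := by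
  simp [h.2.2.1]

theorem IsTypeC.support (h : IsTypeC σ Rs C) :
    (signedWord 1 Rs ++ signedWord (-1) Rs).formPerm.support =
      (signedWord 1 Rs ++ signedWord (-1) Rs).toFinset :=
  support_of_formPerm_mem h.nodup (h.2.2.2 h.mem)

/-- Any one index recovers `C` from `σ`. The same formula serves type (c), where the two cycles
coincide. -/
theorem IsTypeB.eq_cycleOf (h : IsTypeB σ Rs C) {k : Fin n} (hk : k ∈ Rs.flatten) :
    C = {σ.cycleOf (1, k), σ.cycleOf (-1, k)} := by
  obtain ⟨e, h1, h2⟩ := exists_mem_signedWord 1 hk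
  have h3 := cycle_is_cycleOf (by rw [h.support]; exact List.mem_toFinset.2 h1)
    (h.2.2.2 (h.mem 1))
  have h4 := cycle_is_cycleOf (by rw [h.support]; exact List.mem_toFinset.2 h2)
    (h.2.2.2 (h.mem (-1)))
  rw [h.2.2.1, h3, h4]
  rcases Int.units_eq_one_or e with rfl | rfl
  · rfl
  · rw [neg_neg, Finset.pair_comm]

theorem IsTypeC.eq_cycleOf (h : IsTypeC σ Rs C) {k : Fin n} (hk : k ∈ Rs.flatten) :
    C = {σ.cycleOf (1, k), σ.cycleOf (-1, k)} := by
  obtain ⟨e, h1, h2⟩ := exists_mem_signedWord 1 hk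
  have key (e' : ℤˣ) : (signedWord 1 Rs ++ signedWord (-1) Rs).formPerm = σ.cycleOf (e', k) := by
    refine cycle_is_cycleOf ?_ (h.2.2.2 h.mem)
    rw [h.support, List.mem_toFinset, List.mem_append]
    by_cases he : e' = e
    · exact Or.inl (he ▸ h1)
    · exact Or.inr (Int.units_ne_iff_eq_neg.1 he ▸ h2)
  rw [h.2.2.1, ← key, ← key, Finset.pair_eq_singleton]

/-- The right side does not mention `Rs`, so the set of indices in the blocks does not depend on how
`C` is written. -/
theorem IsTypeB.mem_flatten_iff (h : IsTypeB σ Rs C) (k : Fin n) :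
    k ∈ Rs.flatten ↔ ∃ c ∈ C, ∃ e, (e, k) ∈ c.support := by
  constructor
  · intro hk
    obtain ⟨e, h1, -⟩ := exists_mem_signedWord 1 hk
    exact ⟨_, h.mem 1, e, by rw [h.support]; exact List.mem_toFinset.2 h1⟩
  · rintro ⟨c, hc, e, hk⟩
    rw [h.2.2.1] at hc
    rcases Finset.mem_insert.1 hc with rfl | hc
    · rw [h.support, List.mem_toFinset] at hk
      rw [← map_snd_signedWord Rs 1]
      exact List.mem_map_of_mem (f := Prod.snd) hk
    · rw [Finset.mem_singleton.1 hc, h.support, List.mem_toFinset] at hk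
      rw [← map_snd_signedWord Rs (-1)]
      exact List.mem_map_of_mem (f := Prod.snd) hk

theorem IsTypeC.mem_flatten_iff (h : IsTypeC σ Rs C) (k : Fin n) :
    k ∈ Rs.flatten ↔ ∃ c ∈ C, ∃ e, (e, k) ∈ c.support := by
  constructor
  · intro hk
    obtain ⟨e, h1, -⟩ := exists_mem_signedWord 1 hk
    exact ⟨_, h.mem, e, by
      rw [h.support]; exact List.mem_toFinset.2 (List.mem_append_left _ h1)⟩
  · rintro ⟨c, hc, e, hk⟩
    rw [h.2.2.1] at hc
    rw [Finset.mem_singleton.1 hc, h.support, List.mem_toFinset, List.mem_append] at hk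
    rcases hk with hk | hk
    · rw [← map_snd_signedWord Rs 1]
      exact List.mem_map_of_mem (f := Prod.snd) hk
    · rw [← map_snd_signedWord Rs (-1)]
      exact List.mem_map_of_mem (f := Prod.snd) hk

theorem exists_signedWord_eq_cons (h : IsBlockList Rs) (h0 : Rs ≠ []) (e : ℤˣ) :
    ∃ a t, signedWord e Rs = (e, a) :: t := by
  rcases Rs with - | ⟨- | ⟨a, R⟩, Rs⟩
  · exact absurd rfl h0
  · exact absurd rfl (h.1 _ List.mem_cons_self).1
  · exact ⟨a, _, rfl⟩

theorem IsTypeB.ne_nil (h : IsTypeB σ Rs C) : Rs ≠ [] := by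
  obtain ⟨m, hm, hl⟩ := h.2.1
  rintro rfl
  simp at hl
  omega

theorem IsTypeC.ne_nil (h : IsTypeC σ Rs C) : Rs ≠ [] := by
  obtain ⟨m, hm, hl⟩ := h.2.1
  rintro rfl
  simp at hl
  omega

theorem IsTypeB.card_eq (h : IsTypeB σ Rs C) : C.card = 2 := by
  rw [h.2.2.1]
  refine Finset.card_pair fun heq => ?_
  obtain ⟨a, t, ha⟩ := exists_signedWord_eq_cons h.1 h.ne_nil 1
  have h1 : ((1, a) : SignedIndex n) ∈ signedWord 1 Rs := by simp [ha]
  have h2 : negIndex ((1, a) : SignedIndex n) ∈ signedWord (-1) Rs := by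
    rw [signedWord_neg]
    exact List.mem_map_of_mem h1
  rw [← List.mem_toFinset, ← h.support, ← heq, h.support, List.mem_toFinset] at h2
  exact negIndex_notMem (nodup_map_snd_signedWord h.1 1) h1 h2

theorem IsTypeC.card_eq (h : IsTypeC σ Rs C) : C.card = 1 := by
  rw [h.2.2.1, Finset.card_singleton]

theorem IsTypeB.card_support (h : IsTypeB σ Rs C) {c : Equiv.Perm (SignedIndex n)} (hc : c ∈ C) :
    c.support.card = (Rs.map List.length).sum := by
  have key (e : ℤˣ) :
      (signedWord e Rs).formPerm.support.card = (Rs.map List.length).sum := by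
    rw [h.support, List.toFinset_card_of_nodup
      (List.Nodup.of_map _ (nodup_map_snd_signedWord h.1 e)), length_signedWord]
  rw [h.2.2.1] at hc
  rcases Finset.mem_insert.1 hc with rfl | hc
  · exact key 1
  · rw [Finset.mem_singleton.1 hc]
    exact key (-1)

theorem IsTypeC.card_support (h : IsTypeC σ Rs C) {c : Equiv.Perm (SignedIndex n)} (hc : c ∈ C) :
    c.support.card = 2 * (Rs.map List.length).sum := by
  rw [h.2.2.1] at hc
  rw [Finset.mem_singleton.1 hc, h.support, List.toFinset_card_of_nodup h.nodup,
    List.length_append, length_signedWord, length_signedWord, two_mul]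

variable (σ) in
/-- `C` is an even pair of cycles of type (b) or an odd cycle of type (c), with the blocks `Rs`. -/
def IsEvenBOrOddC (Rs : List (List (Fin n))) (C : Finset (Equiv.Perm (SignedIndex n))) : Prop :=
  IsTypeB σ Rs C ∧ Even (Rs.map List.length).sum ∨ IsTypeC σ Rs C ∧ Odd (Rs.map List.length).sum

/-- The cardinality of `C` tells the types apart and the size of a support gives `∑ |R_i|`, so type
and parity are the same for every way of writing `C`. -/
theorem isEvenBOrOddC_of_mem (hC : C ∈ evenTypeB σ ∪ oddTypeC σ)
    (h : IsTypeB σ Rs C ∨ IsTypeC σ Rs C) : IsEvenBOrOddC σ Rs C := by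
  rcases hC with ⟨Rs', h', he⟩ | ⟨Rs', h', he⟩ <;> rcases h with h | h
  · refine Or.inl ⟨h, ?_⟩
    rwa [← h.card_support (h.mem 1), h'.card_support (h.mem 1)]
  · have := h.card_eq.symm.trans h'.card_eq
    omega
  · have := h.card_eq.symm.trans h'.card_eq
    omega
  · refine Or.inr ⟨h, ?_⟩
    have := (h.card_support h.mem).symm.trans (h'.card_support h.mem)
    rwa [show (Rs.map List.length).sum = (Rs'.map List.length).sum by omega]

theorem IsEvenBOrOddC.mem_union (h : IsEvenBOrOddC σ Rs C) : C ∈ evenTypeB σ ∪ oddTypeC σ := by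
  rcases h with ⟨h, he⟩ | ⟨h, he⟩
  · exact Or.inl ⟨Rs, h, he⟩
  · exact Or.inr ⟨Rs, h, he⟩

theorem IsEvenBOrOddC.mem_flatten_iff (h : IsEvenBOrOddC σ Rs C) (k : Fin n) :
    k ∈ Rs.flatten ↔ ∃ c ∈ C, ∃ e, (e, k) ∈ c.support := by
  rcases h with ⟨h, -⟩ | ⟨h, -⟩ <;> exact h.mem_flatten_iff k

theorem IsEvenBOrOddC.eq_cycleOf (h : IsEvenBOrOddC σ Rs C) {k : Fin n} (hk : k ∈ Rs.flatten) :
    C = {σ.cycleOf (1, k), σ.cycleOf (-1, k)} := by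
  rcases h with ⟨h, -⟩ | ⟨h, -⟩ <;> exact h.eq_cycleOf hk

theorem IsEvenBOrOddC.isBlockList (h : IsEvenBOrOddC σ Rs C) : IsBlockList Rs := by
  rcases h with ⟨h, -⟩ | ⟨h, -⟩ <;> exact h.1

theorem IsEvenBOrOddC.ne_nil (h : IsEvenBOrOddC σ Rs C) : Rs ≠ [] := by
  rcases h with ⟨h, -⟩ | ⟨h, -⟩ <;> exact h.ne_nil

/-- The first entry of `R_1`, if there is one. -/
theorem IsEvenBOrOddC.exists_head (h : IsEvenBOrOddC σ Rs C) :
    ∃ a t, signedWord 1 Rs = (1, a) :: t ∧ Rs.flatten = a :: t.map Prod.snd := by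
  obtain ⟨a, t, ha⟩ := exists_signedWord_eq_cons h.isBlockList h.ne_nil 1
  exact ⟨a, t, ha, by rw [← map_snd_signedWord Rs 1, ha]; rfl⟩

theorem IsEvenBOrOddC.pow_apply (h : IsEvenBOrOddC σ Rs C) {a : Fin n} {t : List (SignedIndex n)}
    (ha : signedWord 1 Rs = (1, a) :: t) {j : ℕ} (hj : j < (signedWord 1 Rs).length) :
    (σ ^ j) (1, a) = (signedWord 1 Rs)[j] := by
  rcases h with ⟨h, -⟩ | ⟨h, -⟩
  · have h1 := List.Nodup.of_map _ (nodup_map_snd_signedWord h.1 1)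
    have h2 := h.2.2.2 (h.mem 1)
    rw [ha] at h1 h2
    rw [pow_apply_of_formPerm_mem h1 h2]
    simp only [ha] at hj ⊢
    simp only [Nat.mod_eq_of_lt hj]
  · have h1 := h.nodup
    have h2 := h.2.2.2 h.mem
    rw [ha, List.cons_append] at h1 h2
    rw [pow_apply_of_formPerm_mem h1 h2]
    have hj' : j < ((1, a) :: (t ++ signedWord (-1) Rs)).length := by
      rw [ha] at hj
      simp at hj ⊢
      omega
    simp only [Nat.mod_eq_of_lt hj']
    simp only [ha] at hj ⊢
    exact List.getElem_append_left (as := (1, a) :: t) hj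

/-- Type (b) returns to `a` after an even number of steps, and type (c) reaches `-a` after an odd
number, halfway round. This common form makes `-1` an eigenvalue. -/
theorem IsEvenBOrOddC.pow_length_apply (h : IsEvenBOrOddC σ Rs C) {a : Fin n}
    {t : List (SignedIndex n)} (ha : signedWord 1 Rs = (1, a) :: t) :
    (σ ^ (Rs.map List.length).sum) (1, a) = ((-1) ^ (Rs.map List.length).sum, a) := by
  have hlen := length_signedWord 1 Rs
  rcases h with ⟨h, he⟩ | ⟨h, he⟩
  · have h1 := List.Nodup.of_map _ (nodup_map_snd_signedWord h.1 1)
    have h2 := h.2.2.2 (h.mem 1)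
    rw [ha] at h1 h2 hlen
    rw [pow_apply_of_formPerm_mem h1 h2, he.neg_one_pow]
    simp only [hlen, Nat.mod_self]
    rfl
  · have h1 := h.nodup
    have h2 := h.2.2.2 h.mem
    rw [signedWord_neg, ha, List.cons_append] at h1 h2
    rw [ha] at hlen
    rw [pow_apply_of_formPerm_mem h1 h2, he.neg_one_pow]
    have hj' : (Rs.map List.length).sum <
        ((1, a) :: (t ++ List.map negIndex ((1, a) :: t))).length := by
      simp at hlen ⊢
      omega
    simp only [Nat.mod_eq_of_lt hj']
    have h3 := List.getElem_append_right (as := (1, a) :: t)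
      (bs := List.map negIndex ((1, a) :: t)) (i := (Rs.map List.length).sum)
      (h₁ := by rw [hlen]) (h₂ := by simpa using hj')
    refine h3.trans ?_
    simp [hlen, negIndex]

theorem IsEvenBOrOddC.flatten_eq (h : IsEvenBOrOddC σ Rs C) {a : Fin n}
    {t : List (SignedIndex n)} (ha : signedWord 1 Rs = (1, a) :: t) :
    Rs.flatten = (List.range (Rs.map List.length).sum).map fun j => ((σ ^ j) (1, a)).2 := by
  rw [← map_snd_signedWord Rs 1]
  refine List.ext_getElem (by simp [length_signedWord]) fun i h1 h2 => ?_
  simp only [List.getElem_map, List.getElem_range]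
  rw [h.pow_apply ha]

/-- The blocks of different cycles are disjoint. -/
theorem IsEvenBOrOddC.eq_of_mem (h : IsEvenBOrOddC σ Rs C) {Rs' : List (List (Fin n))}
    {C' : Finset (Equiv.Perm (SignedIndex n))} (h' : IsEvenBOrOddC σ Rs' C') {k : Fin n}
    (hk : k ∈ Rs.flatten) (hk' : k ∈ Rs'.flatten) : C = C' :=
  (h.eq_cycleOf hk).trans (h'.eq_cycleOf hk').symm

end CycleTypes


/-! ### Existence of the block form -/

section Existence

open Equiv.Perm

variable {n : ℕ} {σ : Equiv.Perm (SignedIndex n)}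

theorem pow_apply_negIndex (hneg : ∀ x, σ (negIndex x) = negIndex (σ x)) (j : ℕ)
    (x : SignedIndex n) : (σ ^ j) (negIndex x) = negIndex ((σ ^ j) x) := by
  induction j with
  | zero => rfl
  | succ j ih => rw [pow_succ', mul_apply, mul_apply, ih, hneg]

/-- An orbit in which the sign is constant consists of one element. -/
theorem exists_sign_change (hle : ∀ x, (σ x).1 = x.1 → x.2 ≤ (σ x).2) {x : SignedIndex n}
    (hx : σ x ≠ x) : ∃ j, ((σ ^ (j + 1)) x).1 ≠ ((σ ^ j) x).1 := by
  by_contra! h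
  have h1 (j : ℕ) : ((σ ^ j) x).1 = x.1 := by
    induction j with
    | zero => rfl
    | succ j ih => rw [h, ih]
  -- A monotone sequence that returns to its start is constant, which makes `x` a fixed point.
  have h2 : Monotone fun j : ℕ => ((σ ^ j) x).2 := monotone_nat_of_le_succ fun j => by
    have := hle ((σ ^ j) x)
    rw [← mul_apply, ← pow_succ'] at this
    exact this (h j)
  have h3 := orderOf_pos σ
  have h4 : ((σ ^ 1) x).2 ≤ ((σ ^ orderOf σ) x).2 := h2 h3
  have h5 : ((σ ^ 0) x).2 ≤ ((σ ^ 1) x).2 := h2 zero_le_one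
  rw [pow_orderOf_eq_one] at h4
  exact hx (Prod.ext (h1 1) (le_antisymm h4 h5))

variable {R : Type*} [CommRing R] {f : SignedIndex n → R}

theorem apply_pow (hf : ∀ x, f (σ x) = -f x) (j : ℕ) (x : SignedIndex n) :
    f ((σ ^ j) x) = (-1) ^ j * f x := by
  induction j with
  | zero => simp
  | succ j ih =>
    rw [pow_succ', mul_apply, hf, ih]
    ring

theorem apply_ne_zero_of_snd_eq (hf : ∀ x, f (negIndex x) = -f x) {x y : SignedIndex n}
    (hxy : x.2 = y.2) (hx : f x ≠ 0) : f y ≠ 0 := by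
  rcases eq_or_eq_negIndex hxy with rfl | rfl
  · exact hx
  · rw [hf] at hx
    exact neg_ne_zero.1 hx

variable [NoZeroDivisors R] [CharZero R]

theorem neg_one_pow_mul_eq_iff {r : ℕ} {c : R} (hc : c ≠ 0) :
    ((-1) ^ r * c = c ↔ Even r) ∧ ((-1) ^ r * c = -c ↔ Odd r) := by
  have h : c ≠ -c := fun h => hc (self_eq_neg.1 h)
  rcases Nat.even_or_odd r with hr | hr
  · simp [hr.neg_one_pow, hr, h]
  · simp [hr.neg_one_pow, hr, h.symm]

/-- If a function changes its sign under `σ` and under negation, then it vanishes outside of the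
even pairs of type (b) and the odd cycles of type (c). -/
theorem exists_isEvenBOrOddC (hneg : ∀ x, σ (negIndex x) = negIndex (σ x))
    (hle : ∀ x, (σ x).1 = x.1 → x.2 ≤ (σ x).2) (hf : ∀ x, f (σ x) = -f x)
    (hf' : ∀ x, f (negIndex x) = -f x) {x : SignedIndex n} (hx : f x ≠ 0) :
    ∃ a : Fin n, f (1, a) ≠ 0 ∧ ∃ Rs C, IsEvenBOrOddC σ Rs C ∧ a ∈ Rs.flatten := by
  have hσ {y : SignedIndex n} (hy : f y ≠ 0) : σ y ≠ y := fun h => by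
    have h1 := hf y
    rw [h] at h1
    exact hy (self_eq_neg.1 h1)
  -- The word has to start at a block boundary, so `a` is chosen just after a change of sign;
  -- negating if necessary makes the change go from negative to positive.
  obtain ⟨p, a, hpa, hp, hfp⟩ :
      ∃ (p : SignedIndex n) (a : Fin n), σ p = (1, a) ∧ p.1 = -1 ∧ f p ≠ 0 := by
    obtain ⟨j, hj⟩ := exists_sign_change hle (hσ hx)
    rw [pow_succ', mul_apply] at hj
    have hy : f ((σ ^ j) x) ≠ 0 := by
      rw [apply_pow hf]
      exact mul_ne_zero (pow_ne_zero _ (neg_ne_zero.2 one_ne_zero)) hx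
    generalize (σ ^ j) x = y at hj hy
    rcases Int.units_eq_one_or (σ y).1 with h | h
    · refine ⟨y, (σ y).2, Prod.ext h rfl, ?_, hy⟩
      rw [h] at hj
      exact (Int.units_ne_iff_eq_neg.1 hj.symm)
    · refine ⟨negIndex y, (σ y).2, ?_, ?_, by rwa [hf', neg_ne_zero]⟩
      · rw [hneg]
        exact Prod.ext (by simp [negIndex, h]) rfl
      · rw [h] at hj
        have := Int.units_ne_iff_eq_neg.1 hj.symm
        simpa [negIndex] using this
  have ha : f (1, a) ≠ 0 := by rwa [← hpa, hf, neg_ne_zero]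
  refine ⟨a, ha, ?_⟩
  -- Here `s + 1` is the first return time of the absolute value.
  obtain ⟨s, hs, hmin⟩ : ∃ s, ((σ ^ (s + 1)) (1, a)).2 = a ∧
      ∀ j < s + 1, 0 < j → ((σ ^ j) (1, a)).2 ≠ a := by
    have hex : ∃ r, 0 < r ∧ ((σ ^ r) (1, a)).2 = a :=
      ⟨orderOf σ, orderOf_pos σ, by simp [pow_orderOf_eq_one]⟩
    obtain ⟨h1, h2⟩ := Nat.find_spec hex
    have h3 (j : ℕ) (hj : j < Nat.find hex) (h0 : 0 < j) : ((σ ^ j) (1, a)).2 ≠ a :=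
      fun h => Nat.find_min hex hj ⟨h0, h⟩
    obtain ⟨s, hs⟩ := Nat.exists_eq_add_of_lt h1
    rw [show Nat.find hex = s + 1 by omega] at h2 h3
    exact ⟨s, h2, h3⟩
  have hinj (i j : ℕ) (hij : i < j) (hj : j < s + 1) :
      ((σ ^ i) (1, a)).2 ≠ ((σ ^ j) (1, a)).2 := fun h => by
    refine hmin (j - i) (by omega) (by omega) ?_
    have h1 : (σ ^ j) (1, a) = (σ ^ i) ((σ ^ (j - i)) (1, a)) := by
      rw [← mul_apply, ← pow_add, Nat.add_sub_cancel' hij.le]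
    rcases eq_or_eq_negIndex h.symm with h2 | h2
    · rw [(σ ^ i).injective (h1.symm.trans h2)]
    · rw [← pow_apply_negIndex hneg] at h2
      rw [(σ ^ i).injective (h1.symm.trans h2)]
      rfl
  set t := (List.range s).map fun j => (σ ^ (j + 1)) (1, a) with ht
  have hl : ((List.range (s + 1)).map fun j => (σ ^ j) (1, a)) = (1, a) :: t := by
    simp [List.range_succ_eq_map, ht]
  -- `hle` gives the weak inequality; equality would be a fixed point, where `f` vanishes.
  have hchain : (((1, a) : SignedIndex n) :: t).IsChain (fun y z => y.1 = z.1 → y.2 < z.2) := by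
    rw [← hl, List.isChain_map, List.isChain_range_succ]
    intro m _ h
    simp only [Nat.succ_eq_add_one, pow_succ', mul_apply] at h ⊢
    refine lt_of_le_of_ne (hle _ h.symm) fun h2 => hσ ?_ (Prod.ext h.symm h2.symm)
    rw [apply_pow hf]
    exact mul_ne_zero (pow_ne_zero _ (neg_ne_zero.2 one_ne_zero)) ha
  have hlast : (((1, a) : SignedIndex n) :: t).getLast (List.cons_ne_nil _ _) =
      (σ ^ s) (1, a) := by
    have (l : List (SignedIndex n)) (hne : l ≠ [])
        (h : ((List.range (s + 1)).map fun j => (σ ^ j) (1, a)) = l) :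
        l.getLast hne = (σ ^ s) (1, a) := by
      subst h
      simp [List.getLast_eq_getElem]
    exact this _ _ hl
  have hnodup : ((((1, a) : SignedIndex n) :: t).map Prod.snd).Nodup := by
    rw [← hl, List.map_map]
    refine List.Nodup.map_on (fun i hi j hj h => ?_) List.nodup_range
    rw [List.mem_range] at hi hj
    rcases lt_trichotomy i j with hij | hij | hij
    · exact absurd h (hinj i j hij hj)
    · exact hij
    · exact absurd h.symm (hinj j i hij hi)
  obtain ⟨R, Rs, hR, hword, hsign⟩ := exists_signedWord_eq t _ hchain
  simp only at hR hword hsign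
  rw [hlast, one_mul] at hsign
  have hblock : IsBlockList ((a :: R) :: Rs) :=
    ⟨hR, by rw [← map_snd_signedWord _ 1, hword]; exact hnodup⟩
  have hsum : (((a :: R) :: Rs).map List.length).sum = s + 1 := by
    rw [← length_signedWord 1, hword, ← hl]
    simp
  have hword' : signedWord (-1) ((a :: R) :: Rs) =
      (List.range (s + 1)).map fun j => (σ ^ j) (negIndex (1, a)) := by
    rw [signedWord_neg, hword, ← hl, List.map_map]
    exact List.map_congr_left fun j _ => (pow_apply_negIndex hneg j _).symm
  have hf1 := apply_pow hf (s + 1) (1, a)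
  have hpow : σ ((σ ^ s) (1, a)) = (σ ^ (s + 1)) (1, a) := by rw [pow_succ', mul_apply]
  refine ⟨(a :: R) :: Rs, ?_⟩
  rcases eq_or_eq_negIndex (y := (1, a)) hs with hs | hs
  -- The orbit closes at `a`. Its last entry is then `p`, which is negative, so the number of blocks
  -- is even: type (b).
  · rw [hs] at hf1
    have heven := (neg_one_pow_mul_eq_iff ha).1.1 hf1.symm
    rw [σ.injective (hpow.trans (hs.trans hpa.symm)), hp] at hsign
    have hodd : Odd Rs.length := by
      by_contra h
      rw [Nat.not_odd_iff_even] at h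
      rw [h.neg_one_pow] at hsign
      exact absurd hsign (by decide)
    have h2 : 2 ≤ s + 1 := by
      obtain ⟨m, hm⟩ := heven
      omega
    refine ⟨_, Or.inl ⟨⟨hblock, ?_, rfl, ?_⟩, by rwa [hsum]⟩, by simp⟩
    · obtain ⟨m, hm⟩ := hodd
      exact ⟨m + 1, by omega, by rw [List.length_cons, hm]; ring⟩
    · refine Finset.insert_subset ?_ (Finset.singleton_subset_iff.2 ?_)
      · rw [hword, ← hl]
        refine formPerm_mem_cycleFactorsFinset h2 ?_ hs
        rw [hl]
        exact List.Nodup.of_map _ hnodup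
      · rw [hword']
        refine formPerm_mem_cycleFactorsFinset h2 ?_
          (by rw [pow_apply_negIndex hneg, hs])
        rw [← hword']
        exact List.Nodup.of_map _ (nodup_map_snd_signedWord hblock (-1))
  -- The orbit reaches `-a`. The entry before it is `-p`, which is positive, so the number of blocks
  -- is odd: type (c).
  · rw [hs, hf'] at hf1
    have hodd := (neg_one_pow_mul_eq_iff ha).2.1 hf1.symm
    rw [σ.injective (hpow.trans (hs.trans (by rw [hneg, hpa] : _ = σ (negIndex p))))] at hsign
    have heven : Even Rs.length := by
      by_contra h
      rw [Nat.not_even_iff_odd] at h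
      rw [h.neg_one_pow] at hsign
      simp only [negIndex, hp] at hsign
      exact absurd hsign (by decide)
    have hword2 : signedWord 1 ((a :: R) :: Rs) ++ signedWord (-1) ((a :: R) :: Rs) =
        (List.range ((s + 1) + (s + 1))).map fun j => (σ ^ j) (1, a) := by
      rw [hword', hword, ← hl, List.range_add (n := s + 1), List.map_append, List.map_map]
      congr 1
      refine List.map_congr_left fun j _ => ?_
      rw [Function.comp_apply, ← hs, ← mul_apply, ← pow_add, add_comm]
    refine ⟨_, Or.inr ⟨⟨hblock, ?_, rfl, ?_⟩, by rwa [hsum]⟩, by simp⟩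
    · obtain ⟨m, hm⟩ := heven
      exact ⟨m + 1, by omega, by rw [List.length_cons, hm]; omega⟩
    · rw [Finset.singleton_subset_iff, hword2]
      refine formPerm_mem_cycleFactorsFinset (by omega) ?_
        (by rw [pow_add, mul_apply, hs, pow_apply_negIndex hneg, hs, negIndex_negIndex])
      rw [← hword2, signedWord_neg]
      exact nodup_append_map_negIndex (nodup_map_snd_signedWord hblock 1)

end Existence


/-! ### Eigenvectors of signed permutations -/

section Eigenvectors

variable (𝕜 : Type*) [Field 𝕜] {n : ℕ}

/-- The coordinate of a vector at the signed index `±k`, that is, `±` its component at `k`. -/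
def signedCoord (x : SignedIndex n) : Module.Dual 𝕜 (Fin n → 𝕜) :=
  ((x.1 : ℤ) : 𝕜) • LinearMap.proj x.2

theorem signedCoord_negIndex (x : SignedIndex n) (u : Fin n → 𝕜) :
    signedCoord 𝕜 (negIndex x) u = -signedCoord 𝕜 x u := by
  simp [signedCoord, negIndex]

theorem signedCoord_one (k : Fin n) (u : Fin n → 𝕜) : signedCoord 𝕜 (1, k) u = u k := by
  simp [signedCoord]

theorem units_cast_mul_self (e : ℤˣ) : ((e : ℤ) : 𝕜) * ((e : ℤ) : 𝕜) = 1 := by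
  rcases Int.units_eq_one_or e with rfl | rfl <;> simp

theorem signedCoord_signedVec_self (x : SignedIndex n) :
    signedCoord 𝕜 x (signedVec 𝕜 x) = 1 := by
  simp [signedCoord, signedVec, units_cast_mul_self]

theorem signedCoord_signedVec_of_ne {x y : SignedIndex n} (h : x.2 ≠ y.2) :
    signedCoord 𝕜 x (signedVec 𝕜 y) = 0 := by
  simp [signedCoord, signedVec, h]

variable {σ : Equiv.Perm (SignedIndex n)} (hneg : ∀ x, σ (negIndex x) = negIndex (σ x))
include hneg

/-- A permutation commuting with negation preserves the pairing of the vectors `±ε_k`: signed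
permutation matrices are orthogonal. -/
theorem signedCoord_apply_signedVec_apply (x y : SignedIndex n) :
    signedCoord 𝕜 (σ x) (signedVec 𝕜 (σ y)) = signedCoord 𝕜 x (signedVec 𝕜 y) := by
  by_cases h : x.2 = y.2
  · rcases eq_or_eq_negIndex h with rfl | rfl
    · simp only [signedCoord_signedVec_self]
    · simp only [hneg, signedCoord_negIndex, signedCoord_signedVec_self]
  · rw [signedCoord_signedVec_of_ne 𝕜 h, signedCoord_signedVec_of_ne]
    intro h'
    rcases eq_or_eq_negIndex h' with h' | h'
    · exact h (by rw [σ.injective h'])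
    · rw [← hneg] at h'
      exact h (by rw [σ.injective h']; rfl)

variable {T : (Fin n → 𝕜) →ₗ[𝕜] (Fin n → 𝕜)}

/-- Translates the eigenvector equation for `T` into a sign change of the coordinates under `σ`. -/
theorem signedCoord_apply (hT : ∀ x, T (signedVec 𝕜 x) = signedVec 𝕜 (σ x)) (x : SignedIndex n)
    (u : Fin n → 𝕜) : signedCoord 𝕜 (σ x) (T u) = signedCoord 𝕜 x u := by
  have : (signedCoord 𝕜 (σ x)).comp T = signedCoord 𝕜 x := by
    refine (Pi.basisFun 𝕜 (Fin n)).ext fun k => ?_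
    have hk : Pi.basisFun 𝕜 (Fin n) k = signedVec 𝕜 (1, k) := by simp [signedVec]
    rw [hk, LinearMap.comp_apply, hT, signedCoord_apply_signedVec_apply 𝕜 hneg]
  exact LinearMap.congr_fun this u

theorem signedMatrix_apply (x : SignedIndex n) :
    signedMatrix 𝕜 σ x.2 (σ x).2 = ((x.1 : ℤ) : 𝕜) * (((σ x).1 : ℤ) : 𝕜) := by
  have key (k : Fin n) : signedMatrix 𝕜 σ k (σ (1, k)).2 = (((σ (1, k)).1 : ℤ) : 𝕜) := by
    have h4 : (-1 : ℤˣ) ≠ 1 := by decide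
    simp only [signedMatrix, Matrix.of_apply]
    rcases Int.units_eq_one_or (σ (1, k)).1 with h | h
    · have hk : σ (1, k) = (1, (σ (1, k)).2) := Prod.ext h rfl
      rw [if_pos hk, h]
      simp
    · have hk : σ (1, k) = (-1, (σ (1, k)).2) := Prod.ext h rfl
      rw [if_neg fun h' => h4 (h.symm.trans (congrArg Prod.fst h')), if_pos hk, h]
      simp
  obtain ⟨e, k⟩ := x
  rcases Int.units_eq_one_or e with rfl | rfl
  · simpa using key k
  · have h := hneg (1, k)
    simp only [negIndex] at h
    rw [h]
    simpa using key k

/-- Each factor is the product of the signs of two consecutive orbit points, so the product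
telescopes. -/
theorem prod_signedMatrix (x : SignedIndex n) (j : ℕ) :
    ∏ l ∈ Finset.range j, signedMatrix 𝕜 σ ((σ ^ l) x).2 ((σ ^ (l + 1)) x).2 =
      ((x.1 : ℤ) : 𝕜) * ((((σ ^ j) x).1 : ℤ) : 𝕜) := by
  induction j with
  | zero => simp [units_cast_mul_self]
  | succ j ih =>
    rw [Finset.prod_range_succ, ih, pow_succ', Equiv.Perm.mul_apply,
      signedMatrix_apply 𝕜 hneg, mul_assoc, ← mul_assoc (((((σ ^ j) x).1 : ℤˣ) : ℤ) : 𝕜),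
      units_cast_mul_self, one_mul]

variable {Rs : List (List (Fin n))} {C : Finset (Equiv.Perm (SignedIndex n))} {a : Fin n}
  {t : List (SignedIndex n)}

/-- The matrix entries only supply the signs of the orbit points, leaving an alternating orbit sum.
-/
theorem cycleVector_eq (ha : signedWord 1 Rs = (1, a) :: t) :
    cycleVector 𝕜 σ Rs = ∑ j ∈ Finset.range (Rs.map List.length).sum,
      (-1 : 𝕜) ^ j • signedVec 𝕜 ((σ ^ j) (1, a)) := by
  have hfl : Rs.flatten = a :: t.map Prod.snd := by
    rw [← map_snd_signedWord Rs 1, ha]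
    rfl
  rw [cycleVector, hfl]
  refine Finset.sum_congr rfl fun j _ => ?_
  rw [prod_signedMatrix 𝕜 hneg, signedVec, ← Pi.single_smul]
  simp

theorem IsEvenBOrOddC.apply_cycleVector (h : IsEvenBOrOddC σ Rs C)
    (hT : ∀ x, T (signedVec 𝕜 x) = signedVec 𝕜 (σ x)) :
    T (cycleVector 𝕜 σ Rs) = -cycleVector 𝕜 σ Rs := by
  obtain ⟨a, t, ha, -⟩ := h.exists_head
  have h1 := h.pow_length_apply ha
  rw [cycleVector_eq 𝕜 hneg ha]
  set r := (Rs.map List.length).sum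
  have h2 : (-1 : 𝕜) ^ r • signedVec 𝕜 ((σ ^ r) (1, a)) = signedVec 𝕜 (1, a) := by
    rw [h1]
    rcases Nat.even_or_odd r with hr | hr
    · simp [hr.neg_one_pow]
    · have := signedVec_negIndex 𝕜 ((1, a) : SignedIndex n)
      simp only [negIndex] at this
      simp [hr.neg_one_pow, this]
  -- The terms at `0` and `r` agree by `h2`; removing either from the sum over `r + 1` terms shows
  -- that the sum is unchanged when shifted by one.
  have h3 := Finset.sum_range_succ (fun j => (-1 : 𝕜) ^ j • signedVec 𝕜 ((σ ^ j) (1, a))) r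
  rw [Finset.sum_range_succ', h2, pow_zero, one_smul, pow_zero, Equiv.Perm.one_apply] at h3
  rw [map_sum, ← add_right_cancel h3, ← Finset.sum_neg_distrib]
  refine Finset.sum_congr rfl fun j _ => ?_
  rw [map_smul, hT, ← Equiv.Perm.mul_apply, ← pow_succ', pow_succ (-1 : 𝕜), mul_neg_one, neg_smul, neg_neg]

theorem IsEvenBOrOddC.cycleVector_apply_of_notMem (h : IsEvenBOrOddC σ Rs C) {k : Fin n}
    (hk : k ∉ Rs.flatten) : cycleVector 𝕜 σ Rs k = 0 := by
  obtain ⟨a, t, ha, -⟩ := h.exists_head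
  rw [h.flatten_eq ha] at hk
  rw [← signedCoord_one 𝕜 k (cycleVector 𝕜 σ Rs), cycleVector_eq 𝕜 hneg ha, map_sum]
  refine Finset.sum_eq_zero fun j hj => ?_
  rw [map_smul, signedCoord_signedVec_of_ne, smul_zero]
  rintro rfl
  exact hk (List.mem_map.2 ⟨j, List.mem_range.2 (Finset.mem_range.1 hj), rfl⟩)

theorem IsEvenBOrOddC.cycleVector_apply_head (h : IsEvenBOrOddC σ Rs C)
    (ha : signedWord 1 Rs = (1, a) :: t) : cycleVector 𝕜 σ Rs a = 1 := by
  have hpos : 0 < (Rs.map List.length).sum := by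
    rw [← length_signedWord 1, ha]
    simp
  have hnd := h.isBlockList.2
  rw [h.flatten_eq ha] at hnd
  rw [← signedCoord_one 𝕜 a (cycleVector 𝕜 σ Rs), cycleVector_eq 𝕜 hneg ha, map_sum,
    Finset.sum_eq_single_of_mem 0 (Finset.mem_range.2 hpos)]
  · simp [signedCoord_signedVec_self]
  · intro j hj hj0
    rw [map_smul, signedCoord_signedVec_of_ne, smul_zero]
    intro heq
    exact hj0 (List.inj_on_of_nodup_map hnd (List.mem_range.2 (Finset.mem_range.1 hj))
      (List.mem_range.2 hpos) (by simpa using heq.symm))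

end Eigenvectors


/-! ### The basis of the kernel. -/

section Kernel

variable (𝕜 : Type*) [Field 𝕜] {n : ℕ} (Δ : Finset (Box n))

theorem mem_kernel_iff (u : Fin n → 𝕜) : u ∈ kernel 𝕜 Δ ↔
    ((subElt 𝕜 Δ).toLinearMap ∘ₗ (maxElt 𝕜 n).symm.toLinearMap) (maxElt 𝕜 n u) =
      -maxElt 𝕜 n u := by
  simp [kernel, eq_neg_iff_add_eq_zero]

theorem pipePerm_negIndex (x : SignedIndex n) :
    pipePerm Δ (negIndex x) = negIndex (pipePerm Δ x) :=
  pipeEnd_negIndex Δ x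

theorem exists_basis_kernel [CharZero 𝕜]
    (R : ↥(evenTypeB (pipePerm Δ) ∪ oddTypeC (pipePerm Δ)) → List (List (Fin n)))
    (hR : ∀ C, IsTypeB (pipePerm Δ) (R C) C ∨ IsTypeC (pipePerm Δ) (R C) C) :
    ∃ b : Module.Basis ↥(evenTypeB (pipePerm Δ) ∪ oddTypeC (pipePerm Δ)) 𝕜 (kernel 𝕜 Δ),
      ∀ C, maxElt 𝕜 n (b C : Fin n → 𝕜) = cycleVector 𝕜 (pipePerm Δ) (R C) := by
  have hneg := pipePerm_negIndex Δ
  have hle : ∀ x, (pipePerm Δ x).1 = x.1 → x.2 ≤ (pipePerm Δ x).2 := le_pipeEnd Δ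
  have hT : ∀ x, ((subElt 𝕜 Δ).toLinearMap ∘ₗ (maxElt 𝕜 n).symm.toLinearMap) (signedVec 𝕜 x) =
      signedVec 𝕜 (pipePerm Δ x) := subElt_maxElt_symm_signedVec 𝕜 Δ
  have hC C : IsEvenBOrOddC (pipePerm Δ) (R C) C := isEvenBOrOddC_of_mem C.2 (hR C)
  choose a t ha hfl using fun C => (hC C).exists_head
  have hmem C : (maxElt 𝕜 n).symm (cycleVector 𝕜 (pipePerm Δ) (R C)) ∈ kernel 𝕜 Δ := by
    rw [mem_kernel_iff, LinearEquiv.apply_symm_apply]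
    exact (hC C).apply_cycleVector 𝕜 hneg hT
  -- The dual functionals read off the coordinate of `w u` at the first entry of each `R_1`.
  have hdual : Module.DualBases (R := 𝕜)
      (fun C => (⟨_, hmem C⟩ : kernel 𝕜 Δ))
      (fun C => LinearMap.proj (a C) ∘ₗ (maxElt 𝕜 n).toLinearMap ∘ₗ (kernel 𝕜 Δ).subtype) := by
    refine ⟨fun C => ?_, fun C C' hne => ?_, fun {u₁ u₂} h => ?_, fun _ => Set.toFinite _⟩
    · simpa using (hC C).cycleVector_apply_head 𝕜 hneg (ha C)
    · have : a C ∉ (R C').flatten := fun hmem' =>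
        hne (Subtype.ext ((hC C).eq_of_mem (hC C') (by simp [hfl]) hmem'))
      simpa using (hC C').cycleVector_apply_of_notMem 𝕜 hneg this
    -- Separation: a nonzero coordinate of `w u` would lead to a nonzero coordinate on one of the
    -- listed orbits, which propagates along the orbit to its head, where it is zero.
    · rw [← sub_eq_zero]
      replace h C : maxElt 𝕜 n (u₁ - u₂ : kernel 𝕜 Δ) (a C) = 0 := by
        simpa [sub_eq_zero] using h C
      generalize u₁ - u₂ = u at h
      have hu := (mem_kernel_iff 𝕜 Δ u).1 u.2
      have hf x : signedCoord 𝕜 (pipePerm Δ x) (maxElt 𝕜 n u) =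
          -signedCoord 𝕜 x (maxElt 𝕜 n u) := by
        rw [← signedCoord_apply 𝕜 hneg hT x, hu, map_neg, neg_neg]
      have hf' x := signedCoord_negIndex 𝕜 x (maxElt 𝕜 n u)
      have h0 : maxElt 𝕜 n u = 0 := by
        ext k
        by_contra hk
        rw [← signedCoord_one 𝕜 k (maxElt 𝕜 n u)] at hk
        obtain ⟨a', ha', Rs, C, hRs, hmem'⟩ := exists_isEvenBOrOddC
          (f := fun x => signedCoord 𝕜 x (maxElt 𝕜 n u)) hneg hle hf hf' hk
        let C' : ↥(evenTypeB (pipePerm Δ) ∪ oddTypeC (pipePerm Δ)) := ⟨C, hRs.mem_union⟩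
        -- `Rs` and the prescribed `R C'` may be different ways of writing the same `C`, but they
        -- contain the same indices.
        have h1 : a' ∈ (R C').flatten :=
          ((hC C').mem_flatten_iff a').2 ((hRs.mem_flatten_iff a').1 hmem')
        rw [(hC C').flatten_eq (ha C')] at h1
        obtain ⟨j, -, hj⟩ := List.mem_map.1 h1
        refine apply_ne_zero_of_snd_eq (f := fun x => signedCoord 𝕜 x (maxElt 𝕜 n u)) hf'
          (y := (pipePerm Δ ^ j) (1, a C')) hj.symm ha' ?_
        rw [apply_pow (f := fun x => signedCoord 𝕜 x (maxElt 𝕜 n u)) hf, signedCoord_one, h,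
          mul_zero]
      exact Subtype.ext ((LinearEquiv.map_eq_zero_iff _).1 h0)
  exact ⟨hdual.basis, fun C => by rw [hdual.coe_basis, LinearEquiv.apply_symm_apply]⟩

theorem disjoint_evenTypeB_oddTypeC (σ : Equiv.Perm (SignedIndex n)) :
    Disjoint (evenTypeB σ) (oddTypeC σ) := by
  refine Set.disjoint_left.2 ?_
  rintro C ⟨Rs, h, -⟩ ⟨Rs', h', -⟩
  have := h.card_eq.symm.trans h'.card_eq
  omega

end Kernel

end TypeB

theorem mainTheorem4 (𝕜 : Type*) [Field 𝕜] [CharZero 𝕜] (n : ℕ) (Δ : Finset (TypeB.Box n))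
    (hΔ : TypeB.IsCauchon 𝕜 Δ) :
    Module.finrank 𝕜 (TypeB.kernel 𝕜 Δ) =
        (TypeB.evenTypeB (TypeB.pipePerm Δ)).ncard + (TypeB.oddTypeC (TypeB.pipePerm Δ)).ncard ∧
      ∀ R : ↥(TypeB.evenTypeB (TypeB.pipePerm Δ) ∪ TypeB.oddTypeC (TypeB.pipePerm Δ)) →
          List (List (Fin n)),
        (∀ C, TypeB.IsTypeB (TypeB.pipePerm Δ) (R C) C ∨
          TypeB.IsTypeC (TypeB.pipePerm Δ) (R C) C) →
        ∃ b : Module.Basis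
            ↥(TypeB.evenTypeB (TypeB.pipePerm Δ) ∪ TypeB.oddTypeC (TypeB.pipePerm Δ)) 𝕜
            (TypeB.kernel 𝕜 Δ),
          ∀ C, TypeB.maxElt 𝕜 n (b C : Fin n → 𝕜) =
            TypeB.cycleVector 𝕜 (TypeB.pipePerm Δ) (R C) := by
  refine ⟨?_, TypeB.exists_basis_kernel 𝕜 Δ⟩
  have hex : ∀ C : ↥(TypeB.evenTypeB (TypeB.pipePerm Δ) ∪ TypeB.oddTypeC (TypeB.pipePerm Δ)),
      ∃ Rs, TypeB.IsTypeB (TypeB.pipePerm Δ) Rs C ∨ TypeB.IsTypeC (TypeB.pipePerm Δ) Rs C := by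
    rintro ⟨C, ⟨Rs, h, -⟩ | ⟨Rs, h, -⟩⟩
    · exact ⟨Rs, Or.inl h⟩
    · exact ⟨Rs, Or.inr h⟩
  choose R hR using hex
  obtain ⟨b, -⟩ := TypeB.exists_basis_kernel 𝕜 Δ R hR
  rw [Module.finrank_eq_nat_card_basis b, Nat.card_coe_set_eq,
    Set.ncard_union_eq (TypeB.disjoint_evenTypeB_oddTypeC _)]
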